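/- Conventions. "Measurable" means Lebesgue measurable and $|\cdot|$ is Lebesgue measure. A measurable set $\Omega\subset\mathbb R^d$ with $0<|\Omega|<\infty$ tiles $\mathbb R^d$ (by translations) if there is a countable set $A\subset\mathbb R^d$ such that almost every point of $\mathbb R^d$ lies in $\Omega+a$ for exactly one $a\in A$; a set which is not of positive finite measure does not tile. A finite set $S\subset\mathbb Z^k$ tiles $\mathbb Z^k$ if there is $T\subset\mathbb Z^k$ such that the sets $S+t$, $t\in T$, form a partition of $\mathbb Z^k$. A measurable set $\Omega\subset\mathbb R^d$ with $0<|\Omega|<\infty$ is spectral if there is $\Lambda\subset\mathbb R^d$ such that the exponentials $e^{2\pi i\lambda\cdot x}$, $\lambda\in\Lambda$, form an orthogonal basis of $L^2(\Omega)$; a set which is not of positive finite measure is not spectral. Theorem. Let $\Omega\subset\mathbb R^d$ be bounded and measurable. Let $v_0,\dots,v_{n-1}\in\mathbb R^d$ be arbitrary, let $s_0,\dots,s_{n-1}$ be $n$ distinct points of $\mathbb Z^k$, and put $$X=\{(v_j,s_j): j=0,\dots,n-1\}\subset\mathbb R^{d+k},\qquad S=\{s_j: j=0,\dots,n-1\},\qquad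 \Omega'=(\Omega\times[0,1]^k)+X,$$ where $+$ denotes the Minkowski sum (the translates of $\Omega\times[0,1]^k$ by distinct points of $X$ overlap only in null sets, because the $s_j$ are distinct). Then: (i) If $S$ tiles $\mathbb Z^k$, then $\Omega'$ tiles $\mathbb R^{d+k}$ if and only if $\Omega$ tiles $\mathbb R^d$. (ii) If $\Omega\subset\mathbb R^d$ and $S+[0,1]^k\subset\mathbb R^k$ are both spectral, then $\Omega'$ is spectral in $\mathbb R^{d+k}$. -/

import Mathlib

open MeasureTheory
open scoped Pointwise ENNReal

namespace TileSpectral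

/-- A set `Ω ⊆ ℝ^d` is a translational tile of `ℝ^d`: it is Lebesgue measurable, of positive finite
measure, and for some countable `A` the translates `a + Ω`, `a ∈ A`, cover almost every point of
`ℝ^d` exactly once. -/
def Tiles {d : ℕ} (Ω : Set (Fin d → ℝ)) : Prop :=
  NullMeasurableSet Ω volume ∧ 0 < volume Ω ∧ volume Ω < ∞ ∧
    ∃ A : Set (Fin d → ℝ), A.Countable ∧
      ∀ᵐ x : Fin d → ℝ, ∃! a : Fin d → ℝ, a ∈ A ∧ x ∈ a +ᵥ Ω

/-- A finite set `S ⊆ ℤ^k` tiles `ℤ^k`: for some `T` the translates `t + S`, `t ∈ T`, form a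
partition of `ℤ^k`. -/
def TilesInt {k : ℕ} (S : Set (Fin k → ℤ)) : Prop :=
  S.Finite ∧ ∃ T : Set (Fin k → ℤ), ∀ z : Fin k → ℤ, ∃! t : Fin k → ℤ, t ∈ T ∧ z ∈ t +ᵥ S

/-- The exponential `x ↦ exp (2πi ξ·x)` on `ℝ^d`. -/
noncomputable def expFun {d : ℕ} (ξ x : Fin d → ℝ) : ℂ :=
  Complex.exp (2 * Real.pi * Complex.I * ((ξ ⬝ᵥ x : ℝ) : ℂ))

theorem memLp_expFun {d : ℕ} {Ω : Set (Fin d → ℝ)} (hΩ : volume Ω < ∞) (ξ : Fin d → ℝ) :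
    MemLp (expFun ξ) 2 (volume.restrict Ω) := by
  haveI : IsFiniteMeasure (volume.restrict Ω) := ⟨by simpa using hΩ⟩
  have hc : Continuous (expFun ξ) := by
    unfold expFun dotProduct
    fun_prop
  refine MemLp.of_bound hc.aestronglyMeasurable 1 (Filter.Eventually.of_forall fun x => ?_)
  have h : 2 * (Real.pi : ℂ) * Complex.I * ((ξ ⬝ᵥ x : ℝ) : ℂ)
      = ((2 * Real.pi * (ξ ⬝ᵥ x) : ℝ) : ℂ) * Complex.I := by
    push_cast
    ring
  rw [expFun, h, Complex.norm_exp_ofReal_mul_I]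

/-- The exponential with frequency `ξ` as an element of the Hilbert space `L²(Ω)`. -/
noncomputable def expL2 {d : ℕ} {Ω : Set (Fin d → ℝ)} (hΩ : volume Ω < ∞) (ξ : Fin d → ℝ) :
    Lp ℂ 2 (volume.restrict Ω) :=
  (memLp_expFun hΩ ξ).toLp (expFun ξ)

/-- `Λ` is a spectrum for `Ω` (a set of finite measure): the exponentials with frequencies in `Λ`
are pairwise orthogonal in `L²(Ω)` and their linear span is dense in `L²(Ω)`. -/
def IsSpectrum {d : ℕ} {Ω : Set (Fin d → ℝ)} (hΩ : volume Ω < ∞) (Λ : Set (Fin d → ℝ)) : Prop :=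
  (∀ ξ ∈ Λ, ∀ η ∈ Λ, ξ ≠ η → inner ℂ (expL2 hΩ ξ) (expL2 hΩ η) = 0) ∧
    (Submodule.span ℂ (expL2 hΩ '' Λ)).topologicalClosure = ⊤

/-- A spectral set: Lebesgue measurable, of positive finite measure, and possessing a spectrum. -/
def IsSpectral {d : ℕ} (Ω : Set (Fin d → ℝ)) : Prop :=
  NullMeasurableSet Ω volume ∧ 0 < volume Ω ∧
    ∃ hΩ : volume Ω < ∞, ∃ Λ : Set (Fin d → ℝ), IsSpectrum hΩ Λ

/-- The inclusion `ℤ^k ⊆ ℝ^k`. -/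
def toReal {k : ℕ} (s : Fin k → ℤ) : Fin k → ℝ := fun i => (s i : ℝ)

/-- The closed unit cube `[0,1]^k`. -/
def unitCube (k : ℕ) : Set (Fin k → ℝ) := Set.Icc 0 1

/-- The Cartesian product `A × B ⊆ ℝ^(d+k)` of `A ⊆ ℝ^d` and `B ⊆ ℝ^k`. -/
def cartesian {d k : ℕ} (A : Set (Fin d → ℝ)) (B : Set (Fin k → ℝ)) : Set (Fin (d + k) → ℝ) :=
  Set.image2 Fin.append A B

/-- The set `X = {(v_j, s_j) : j < n} ⊆ ℝ^(d+k)`. -/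
def shifts {d k n : ℕ} (v : Fin n → Fin d → ℝ) (s : Fin n → Fin k → ℤ) :
    Set (Fin (d + k) → ℝ) :=
  Set.range fun j => Fin.append (v j) (toReal (s j))

/-- The set `Ω' = (Ω × [0,1]^k) + X ⊆ ℝ^(d+k)`. When the `s_j` are distinct, the translates that
make up this Minkowski sum automatically overlap only in null sets. -/
def stacked {d k n : ℕ} (Ω : Set (Fin d → ℝ)) (v : Fin n → Fin d → ℝ) (s : Fin n → Fin k → ℤ) :
    Set (Fin (d + k) → ℝ) :=
  cartesian Ω (unitCube k) + shifts v s

end TileSpectral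

namespace TileSpectral

variable {d k n : ℕ}

/-! Off the null set of integer hyperplanes, a height w in ℝ^k lies in at most one cube s_j +
[0,1]^k, the one with s_j equal to the integer part of w. Over such w the fibre of Ω' is therefore Ω
+ v_j, or empty. Translating each fibre by a vector depending only on w preserves measure and turns
(S + [0,1]^k) × Ω into Ω' up to a null set (`layerEquiv_preimage_stacked`).

Tiling: if Ω + A and S + T are tilings, then A × T is a translation set for Ω'. Indeed w singles out
t and s_j, and y - v_j then singles out a. Conversely, a generic slice of a tiling by Ω' is a tiling
by translates of Ω.

Spectrality: with E = S + [0,1]^k, spectra Λ of Ω and M of E give the spectrum Λ × M of Ω'. In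
straightened coordinates the exponential of frequency (ξ, η) is the product of those of ξ and η,
times a unimodular phase depending on ξ and w only. The phase cancels when two frequencies share ξ;
otherwise orthogonality on Ω suffices. For completeness, the phase is harmless in the ξ-th
coefficient of a slice, which is a function of w in L²(E). -/

theorem append_add_append (a c : Fin d → ℝ) (b e : Fin k → ℝ) :
    Fin.append a b + Fin.append c e = Fin.append (a + c) (b + e) := by
  ext i
  refine Fin.addCases (fun i => ?_) (fun i => ?_) i <;> simp

theorem append_inj {a c : Fin d → ℝ} {b e : Fin k → ℝ} :
    Fin.append a b = Fin.append c e ↔ a = c ∧ b = e := by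
  refine ⟨fun h => ⟨?_, ?_⟩, fun h => by rw [h.1, h.2]⟩
  · ext i
    simpa using congrFun h (Fin.castAdd k i)
  · ext i
    simpa using congrFun h (Fin.natAdd d i)

theorem dotProduct_append (a c : Fin d → ℝ) (b e : Fin k → ℝ) :
    Fin.append a b ⬝ᵥ Fin.append c e = a ⬝ᵥ c + b ⬝ᵥ e := by
  simp [dotProduct, Fin.sum_univ_add]

/-- Concatenation of coordinates `ℝ^d × ℝ^k ≃ ℝ^(d+k)`. -/
def appendEquiv (d k : ℕ) : (Fin d → ℝ) × (Fin k → ℝ) ≃ᵐ (Fin (d + k) → ℝ) where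
  toFun p := Fin.append p.1 p.2
  invFun x := (fun i => x (Fin.castAdd k i), fun i => x (Fin.natAdd d i))
  left_inv p := by ext <;> simp
  right_inv x := Fin.append_castAdd_natAdd
  measurable_toFun := by
    refine measurable_pi_iff.2 fun i => ?_
    refine Fin.addCases (fun i => ?_) (fun i => ?_) i
    · simp only [Equiv.coe_fn_mk, Fin.append_left]
      fun_prop
    · simp only [Equiv.coe_fn_mk, Fin.append_right]
      fun_prop
  measurable_invFun := by
    simp only [Equiv.coe_fn_symm_mk]
    fun_prop

theorem appendEquiv_apply (p : (Fin d → ℝ) × (Fin k → ℝ)) :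
    appendEquiv d k p = Fin.append p.1 p.2 := rfl

theorem measurePreserving_appendEquiv (d k : ℕ) :
    MeasurePreserving (appendEquiv d k) volume volume := by
  have h := (volume_measurePreserving_piCongrLeft (fun _ : Fin (d + k) => ℝ)
    finSumFinEquiv).comp
    (volume_measurePreserving_sumPiEquivProdPi_symm (fun _ : Fin d ⊕ Fin k => ℝ))
  convert h using 1
  ext p i
  obtain ⟨i, rfl⟩ := finSumFinEquiv.surjective i
  rw [Function.comp_apply, MeasurableEquiv.coe_piCongrLeft, Equiv.piCongrLeft_apply_apply]
  cases i <;> simp [appendEquiv_apply, MeasurableEquiv.coe_sumPiEquivProdPi_symm,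
    Equiv.sumPiEquivProdPi]

/-! ### Integer layers -/

/-- The coordinatewise integer part. -/
noncomputable def floorVec (w : Fin k → ℝ) : Fin k → ℤ := fun i => ⌊w i⌋

theorem measurable_floorVec : Measurable (floorVec : (Fin k → ℝ) → Fin k → ℤ) :=
  measurable_pi_iff.2 fun i => Int.measurable_floor.comp (measurable_pi_apply i)

/-- The horizontal displacement `v j` of the layer `s j + [0,1)^k` containing `w`, and `0` outside
the layers. -/
noncomputable def layerShift (v : Fin n → Fin d → ℝ) (s : Fin n → Fin k → ℤ) (w : Fin k → ℝ) :
    Fin d → ℝ :=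
  Function.extend s v 0 (floorVec w)

theorem measurable_layerShift (v : Fin n → Fin d → ℝ) (s : Fin n → Fin k → ℤ) :
    Measurable (layerShift v s) :=
  (measurable_of_countable (Function.extend s v 0)).comp measurable_floorVec

theorem layerShift_of_floorVec_eq (v : Fin n → Fin d → ℝ) {s : Fin n → Fin k → ℤ}
    (hs : Function.Injective s) {w : Fin k → ℝ} {j : Fin n} (h : floorVec w = s j) :
    layerShift v s w = v j := by
  rw [layerShift, h, hs.extend_apply]

theorem ae_forall_ne_intCast (k : ℕ) : ∀ᵐ w : Fin k → ℝ, ∀ i, ∀ m : ℤ, w i ≠ m := by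
  refine ae_all_iff.2 fun i => ae_all_iff.2 fun m => ?_
  rw [ae_iff]
  simpa [volume_pi] using Measure.pi_hyperplane (fun _ : Fin k => (volume : Measure ℝ)) i (m : ℝ)

theorem sub_toReal_mem_unitCube_iff {w : Fin k → ℝ} (hw : ∀ i, ∀ m : ℤ, w i ≠ m)
    (t : Fin k → ℤ) : w - toReal t ∈ unitCube k ↔ floorVec w = t := by
  simp only [unitCube, toReal, Set.mem_Icc, Pi.le_def, funext_iff, floorVec, Int.floor_eq_iff,
    Pi.sub_apply, Pi.one_apply, sub_nonneg, ← forall_and]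
  refine forall_congr' fun i => and_congr_right fun _ => ?_
  -- Avoiding integers excludes the upper face, so closed and half-open cubes agree.
  have h := hw i (t i + 1)
  push_cast at h
  rw [sub_le_iff_le_add, add_comm (1 : ℝ)]
  exact ⟨fun h' => lt_of_le_of_ne h' h, le_of_lt⟩

theorem mem_toReal_image_add_unitCube {s : Fin n → Fin k → ℤ} {w : Fin k → ℝ} :
    w ∈ toReal '' Set.range s + unitCube k ↔ ∃ j, w - toReal (s j) ∈ unitCube k := by
  simp only [Set.mem_add, Set.mem_image, Set.mem_range]
  constructor
  · rintro ⟨_, ⟨_, ⟨j, rfl⟩, rfl⟩, q, hq, rfl⟩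
    exact ⟨j, by simpa using hq⟩
  · rintro ⟨j, hj⟩
    exact ⟨_, ⟨_, ⟨j, rfl⟩, rfl⟩, _, hj, by abel⟩

theorem append_mem_stacked {Ω : Set (Fin d → ℝ)} {v : Fin n → Fin d → ℝ} {s : Fin n → Fin k → ℤ}
    {y : Fin d → ℝ} {w : Fin k → ℝ} :
    Fin.append y w ∈ stacked Ω v s ↔ ∃ j, y - v j ∈ Ω ∧ w - toReal (s j) ∈ unitCube k := by
  simp only [stacked, cartesian, shifts, Set.mem_add, Set.mem_image2, Set.mem_range]
  constructor
  · rintro ⟨_, ⟨u, hu, q, hq, rfl⟩, _, ⟨j, rfl⟩, h⟩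
    rw [append_add_append, append_inj] at h
    obtain ⟨rfl, rfl⟩ := h
    exact ⟨j, by simpa using hu, by simpa using hq⟩
  · rintro ⟨j, hu, hq⟩
    exact ⟨_, ⟨_, hu, _, hq, rfl⟩, _, ⟨j, rfl⟩, by rw [append_add_append]; simp⟩

/-- For `w` off the integer hyperplanes, at most one layer meets the height `w`. -/
theorem append_mem_stacked_iff_floorVec {Ω : Set (Fin d → ℝ)} {v : Fin n → Fin d → ℝ}
    {s : Fin n → Fin k → ℤ} {y : Fin d → ℝ} {w : Fin k → ℝ} (hw : ∀ i, ∀ m : ℤ, w i ≠ m) :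
    Fin.append y w ∈ stacked Ω v s ↔ ∃ j, y - v j ∈ Ω ∧ floorVec w = s j := by
  simp only [append_mem_stacked, sub_toReal_mem_unitCube_iff hw]

/-! ### Straightening the stacked set -/

/-- The shear of `ℝ^k × ℝ^d` translating the fibre over `w` by `layerShift v s w`. -/
noncomputable def shearEquiv (v : Fin n → Fin d → ℝ) (s : Fin n → Fin k → ℤ) :
    (Fin k → ℝ) × (Fin d → ℝ) ≃ᵐ (Fin k → ℝ) × (Fin d → ℝ) where
  toFun p := (p.1, p.2 + layerShift v s p.1)
  invFun p := (p.1, p.2 - layerShift v s p.1)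
  left_inv p := by simp
  right_inv p := by simp
  measurable_toFun := measurable_fst.prodMk
    (measurable_snd.add ((measurable_layerShift v s).comp measurable_fst))
  measurable_invFun := measurable_fst.prodMk
    (measurable_snd.sub ((measurable_layerShift v s).comp measurable_fst))

theorem measurePreserving_shearEquiv (v : Fin n → Fin d → ℝ) (s : Fin n → Fin k → ℤ) :
    MeasurePreserving (shearEquiv v s) volume volume :=
  (MeasurePreserving.id volume).skew_product
    (g := fun w (u : Fin d → ℝ) => u + layerShift v s w)
    (measurable_snd.add ((measurable_layerShift v s).comp measurable_fst))
    (Filter.Eventually.of_forall fun _ => (measurePreserving_add_right volume _).map_eq)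

/-- The piecewise translation carrying `(S + [0,1]^k) × Ω` to the stacked set. -/
noncomputable def layerEquiv (v : Fin n → Fin d → ℝ) (s : Fin n → Fin k → ℤ) :
    (Fin k → ℝ) × (Fin d → ℝ) ≃ᵐ (Fin (d + k) → ℝ) :=
  (shearEquiv v s).trans (MeasurableEquiv.prodComm.trans (appendEquiv d k))

theorem layerEquiv_apply (v : Fin n → Fin d → ℝ) (s : Fin n → Fin k → ℤ)
    (p : (Fin k → ℝ) × (Fin d → ℝ)) :
    layerEquiv v s p = Fin.append (p.2 + layerShift v s p.1) p.1 := rfl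

theorem measurePreserving_layerEquiv (v : Fin n → Fin d → ℝ) (s : Fin n → Fin k → ℤ) :
    MeasurePreserving (layerEquiv v s) volume volume :=
  (measurePreserving_appendEquiv d k).comp
    (Measure.measurePreserving_swap.comp (measurePreserving_shearEquiv v s))

theorem layerEquiv_preimage_stacked (Ω : Set (Fin d → ℝ)) (v : Fin n → Fin d → ℝ)
    {s : Fin n → Fin k → ℤ} (hs : Function.Injective s) :
    layerEquiv v s ⁻¹' stacked Ω v s =ᵐ[volume]
      (toReal '' Set.range s + unitCube k) ×ˢ Ω := by
  have h := Measure.quasiMeasurePreserving_fst (μ := (volume : Measure (Fin k → ℝ)))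
    (ν := (volume : Measure (Fin d → ℝ))) |>.ae (ae_forall_ne_intCast k)
  filter_upwards [h] with p hp
  refine propext ?_
  change layerEquiv v s p ∈ stacked Ω v s ↔ p ∈ (toReal '' Set.range s + unitCube k) ×ˢ Ω
  rw [layerEquiv_apply, append_mem_stacked_iff_floorVec hp, Set.mem_prod,
    mem_toReal_image_add_unitCube]
  simp only [sub_toReal_mem_unitCube_iff hp]
  constructor
  · rintro ⟨j, h1, h2⟩
    rw [layerShift_of_floorVec_eq v hs h2] at h1
    exact ⟨⟨j, h2⟩, by simpa using h1⟩
  · rintro ⟨⟨j, h2⟩, h1⟩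
    exact ⟨j, by rw [layerShift_of_floorVec_eq v hs h2]; simpa using h1, h2⟩

/-- Valid without measurability of `Ω`: a measurable equivalence and the product formula for
rectangles both handle arbitrary sets. -/
theorem volume_stacked (Ω : Set (Fin d → ℝ)) (v : Fin n → Fin d → ℝ)
    {s : Fin n → Fin k → ℤ} (hs : Function.Injective s) :
    volume (stacked Ω v s) = volume (toReal '' Set.range s + unitCube k) * volume Ω := by
  rw [← (measurePreserving_layerEquiv v s).measure_preimage_equiv,
    measure_congr (layerEquiv_preimage_stacked Ω v hs), Measure.volume_eq_prod, Measure.prod_prod]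

theorem isCompact_toReal_image_add_unitCube (s : Fin n → Fin k → ℤ) :
    IsCompact (toReal '' Set.range s + unitCube k) :=
  ((Set.finite_range s).image _).isCompact.add isCompact_Icc

theorem volume_toReal_image_add_unitCube_pos (s : Fin n → Fin k → ℤ) (j : Fin n) :
    0 < volume (toReal '' Set.range s + unitCube k) := by
  have h : toReal (s j) +ᵥ unitCube k ⊆ toReal '' Set.range s + unitCube k := by
    rintro _ ⟨q, hq, rfl⟩
    exact Set.add_mem_add ⟨_, ⟨j, rfl⟩, rfl⟩ hq
  refine lt_of_lt_of_le ?_ (measure_mono h)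
  rw [measure_vadd, unitCube, Real.volume_Icc_pi]
  simp

theorem nullMeasurableSet_stacked {Ω : Set (Fin d → ℝ)} (hΩ : NullMeasurableSet Ω volume)
    (v : Fin n → Fin d → ℝ) {s : Fin n → Fin k → ℤ} (hs : Function.Injective s) :
    NullMeasurableSet (stacked Ω v s) volume := by
  have h : NullMeasurableSet (layerEquiv v s ⁻¹' stacked Ω v s) volume :=
    (NullMeasurableSet.prod
      (isCompact_toReal_image_add_unitCube s).measurableSet.nullMeasurableSet hΩ).congr
      (layerEquiv_preimage_stacked Ω v hs).symm
  have h' := h.preimage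
    (measurePreserving_layerEquiv v s).symm.quasiMeasurePreserving
  rwa [← Set.preimage_comp, MeasurableEquiv.self_comp_symm, Set.preimage_id] at h'

/-! ### Tilings -/

theorem mem_vadd_set_iff_sub_mem {Ω : Set (Fin d → ℝ)} {a x : Fin d → ℝ} :
    x ∈ a +ᵥ Ω ↔ x - a ∈ Ω := by
  rw [Set.mem_vadd_set_iff_neg_vadd_mem, vadd_eq_add, neg_add_eq_sub]

theorem append_sub_append (a c : Fin d → ℝ) (b e : Fin k → ℝ) :
    Fin.append a b - Fin.append c e = Fin.append (a - c) (b - e) := by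
  rw [sub_eq_iff_eq_add, append_add_append, sub_add_cancel, sub_add_cancel]

theorem floorVec_sub_toReal (w : Fin k → ℝ) (t : Fin k → ℤ) :
    floorVec (w - toReal t) = floorVec w - t := by
  ext i
  simp [floorVec, toReal]

theorem Tiles.stacked {Ω : Set (Fin d → ℝ)} (hΩ : Tiles Ω) (v : Fin n → Fin d → ℝ)
    {s : Fin n → Fin k → ℤ} (hs : Function.Injective s) (hS : TilesInt (Set.range s)) :
    Tiles (stacked Ω v s) := by
  obtain ⟨hm, hpos, hfin, A, hA, hAt⟩ := hΩ
  obtain ⟨-, T, hT⟩ := hS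
  -- Covering the point 0 forces S to be nonempty.
  obtain ⟨j₀⟩ : Nonempty (Fin n) := by
    obtain ⟨t, ⟨-, ht⟩, -⟩ := hT 0
    obtain ⟨_, ⟨j, -⟩, -⟩ := ht
    exact ⟨j⟩
  refine ⟨nullMeasurableSet_stacked hm v hs, ?_, ?_,
    Set.image2 (fun a t => Fin.append a (toReal t)) A T, hA.image2 T.to_countable _, ?_⟩
  · rw [volume_stacked Ω v hs]
    exact ENNReal.mul_pos (volume_toReal_image_add_unitCube_pos s j₀).ne' hpos.ne'
  · rw [volume_stacked Ω v hs]
    exact ENNReal.mul_lt_top (isCompact_toReal_image_add_unitCube s).measure_lt_top hfin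
  have hy : ∀ᵐ y : Fin d → ℝ, ∀ j, ∃! a : Fin d → ℝ, a ∈ A ∧ y - v j ∈ a +ᵥ Ω :=
    ae_all_iff.2 fun j => (measurePreserving_sub_right volume (v j)).quasiMeasurePreserving.ae hAt
  have hp : ∀ᵐ p : (Fin d → ℝ) × (Fin k → ℝ), ∃! a : Fin (d + k) → ℝ,
      a ∈ Set.image2 (fun a t => Fin.append a (toReal t)) A T ∧
        Fin.append p.1 p.2 ∈ a +ᵥ TileSpectral.stacked Ω v s := by
    rw [Measure.volume_eq_prod]
    filter_upwards [Measure.quasiMeasurePreserving_fst.ae hy,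
      Measure.quasiMeasurePreserving_snd.ae (ae_forall_ne_intCast k)] with ⟨y, w⟩ hy hw
    have key : ∀ (a : Fin d → ℝ) (t : Fin k → ℤ),
        Fin.append y w ∈ Fin.append a (toReal t) +ᵥ TileSpectral.stacked Ω v s ↔
          ∃ j, y - v j ∈ a +ᵥ Ω ∧ floorVec w = t + s j := by
      intro a t
      have hw' : ∀ i, ∀ m : ℤ, (w - toReal t) i ≠ m := fun i m h =>
        hw i (m + t i) (by simp [toReal] at h; push_cast; linarith)
      rw [mem_vadd_set_iff_sub_mem, append_sub_append, append_mem_stacked_iff_floorVec hw',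
        floorVec_sub_toReal]
      simp only [mem_vadd_set_iff_sub_mem, sub_right_comm y a, sub_eq_iff_eq_add']
    obtain ⟨t, ⟨htT, ht⟩, htu⟩ := hT (floorVec w)
    obtain ⟨_, ⟨j, rfl⟩, hj⟩ := ht
    replace hj : t + s j = floorVec w := hj
    obtain ⟨a, ⟨haA, ha⟩, hau⟩ := hy j
    refine ⟨Fin.append a (toReal t), ⟨⟨a, haA, t, htT, rfl⟩, (key a t).2 ⟨j, ha, hj.symm⟩⟩, ?_⟩
    rintro _ ⟨⟨a', ha'A, t', ht'T, rfl⟩, h⟩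
    obtain ⟨j', ha', hj'⟩ := (key a' t').1 h
    obtain rfl : t' = t := htu t' ⟨ht'T, s j', ⟨j', rfl⟩, hj'.symm⟩
    obtain rfl : j' = j := hs (add_left_cancel (hj'.symm.trans hj.symm))
    rw [hau a' ⟨ha'A, ha'⟩]
  filter_upwards [(measurePreserving_appendEquiv d k).symm.quasiMeasurePreserving.ae hp] with x hx
  rwa [← appendEquiv_apply, MeasurableEquiv.apply_symm_apply] at hx

theorem Tiles.of_stacked {Ω : Set (Fin d → ℝ)} (hm : NullMeasurableSet Ω volume)
    {v : Fin n → Fin d → ℝ} {s : Fin n → Fin k → ℤ} (hs : Function.Injective s) (j₀ : Fin n)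
    (h : Tiles (TileSpectral.stacked Ω v s)) : Tiles Ω := by
  obtain ⟨-, hpos, hfin, A, hA, hAt⟩ := h
  rw [volume_stacked Ω v hs] at hpos hfin
  have hE := volume_toReal_image_add_unitCube_pos s j₀
  refine ⟨hm, pos_iff_ne_zero.2 (right_ne_zero_of_mul hpos.ne'),
    ENNReal.lt_top_of_mul_ne_top_right hfin.ne hE.ne', ?_⟩
  have hp := ((measurePreserving_appendEquiv d k).comp
    Measure.measurePreserving_swap).quasiMeasurePreserving.ae hAt
  have hw : ∀ᵐ w : Fin k → ℝ, ∀ a ∈ A, ∀ i, ∀ m : ℤ,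
      (w - fun i => a (Fin.natAdd d i)) i ≠ m :=
    (ae_ball_iff hA).2 fun a _ =>
      (measurePreserving_sub_right volume _).quasiMeasurePreserving.ae (ae_forall_ne_intCast k)
  -- By Fubini, some height avoids the countably many shifted hyperplane families and has a slice
  -- tiled almost everywhere.
  obtain ⟨w, hw, hy⟩ := (hw.and (Measure.ae_ae_of_ae_prod hp)).exists
  simp only [Function.comp_apply, appendEquiv_apply, Prod.fst_swap, Prod.snd_swap] at hy
  have key : ∀ a ∈ A, ∀ y : Fin d → ℝ, Fin.append y w ∈ a +ᵥ TileSpectral.stacked Ω v s ↔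
      ∃ j, y ∈ ((fun i => a (Fin.castAdd k i)) + v j) +ᵥ Ω ∧
        floorVec (w - fun i => a (Fin.natAdd d i)) = s j := by
    intro a ha y
    conv_lhs => rw [← Fin.append_castAdd_natAdd (f := a)]
    rw [mem_vadd_set_iff_sub_mem, append_sub_append, append_mem_stacked_iff_floorVec (hw a ha)]
    simp only [mem_vadd_set_iff_sub_mem, sub_sub]
  -- Each translate meeting height `w` does so in one layer j, where its slice is Ω shifted by v_j
  -- plus the horizontal part of a.
  refine ⟨⋃ j, (fun a i => a (Fin.castAdd k i) + v j i) ''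
    {a ∈ A | floorVec (w - fun i => a (Fin.natAdd d i)) = s j},
    Set.countable_iUnion fun j => (hA.mono (Set.sep_subset _ _)).image _, ?_⟩
  filter_upwards [hy] with y hy
  obtain ⟨a, ⟨haA, ha⟩, hau⟩ := hy
  obtain ⟨j, hj, hwj⟩ := (key a haA y).1 ha
  refine ⟨_, ⟨Set.mem_iUnion.2 ⟨j, a, ⟨haA, hwj⟩, rfl⟩, hj⟩, ?_⟩
  rintro _ ⟨hc, hyc⟩
  obtain ⟨j', a', ⟨ha'A, hwj'⟩, rfl⟩ := Set.mem_iUnion.1 hc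
  obtain rfl : a' = a := hau a' ⟨ha'A, (key a' ha'A y).2 ⟨j', hyc, hwj'⟩⟩
  obtain rfl : j' = j := hs (hwj'.symm.trans hwj)
  rfl

/-! ### Exponentials in L² -/

open ComplexConjugate

theorem norm_expFun (ξ x : Fin d → ℝ) : ‖expFun ξ x‖ = 1 := by
  have h : 2 * (Real.pi : ℂ) * Complex.I * ((ξ ⬝ᵥ x : ℝ) : ℂ)
      = ((2 * Real.pi * (ξ ⬝ᵥ x) : ℝ) : ℂ) * Complex.I := by
    push_cast
    ring
  rw [expFun, h, Complex.norm_exp_ofReal_mul_I]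

theorem conj_expFun_mul_self (ξ x : Fin d → ℝ) : conj (expFun ξ x) * expFun ξ x = 1 := by
  rw [Complex.conj_mul', norm_expFun]
  simp

theorem continuous_expFun (ξ : Fin d → ℝ) : Continuous (expFun ξ) := by
  unfold expFun dotProduct
  fun_prop

theorem expFun_add (ξ x y : Fin d → ℝ) : expFun ξ (x + y) = expFun ξ x * expFun ξ y := by
  rw [expFun, expFun, expFun, ← Complex.exp_add, dotProduct_add]
  push_cast
  ring_nf

theorem expFun_append (ξ x : Fin d → ℝ) (η y : Fin k → ℝ) :
    expFun (Fin.append ξ η) (Fin.append x y) = expFun ξ x * expFun η y := by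
  rw [expFun, expFun, expFun, ← Complex.exp_add, dotProduct_append]
  push_cast
  ring_nf

theorem coeFn_expL2 {Ω : Set (Fin d → ℝ)} (hΩ : volume Ω < ∞) (ξ : Fin d → ℝ) :
    expL2 hΩ ξ =ᵐ[volume.restrict Ω] expFun ξ :=
  (memLp_expFun hΩ ξ).coeFn_toLp

theorem inner_expL2_left {Ω : Set (Fin d → ℝ)} (hΩ : volume Ω < ∞) (ξ : Fin d → ℝ)
    (f : Lp ℂ 2 (volume.restrict Ω)) :
    inner ℂ (expL2 hΩ ξ) f = ∫ x in Ω, conj (expFun ξ x) * f x := by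
  rw [L2.inner_def]
  refine integral_congr_ae ?_
  filter_upwards [coeFn_expL2 hΩ ξ] with x hx
  rw [hx, RCLike.inner_apply, mul_comm]

theorem inner_expL2_expL2 {Ω : Set (Fin d → ℝ)} (hΩ : volume Ω < ∞) (ξ η : Fin d → ℝ) :
    inner ℂ (expL2 hΩ ξ) (expL2 hΩ η) = ∫ x in Ω, conj (expFun ξ x) * expFun η x := by
  rw [inner_expL2_left]
  refine integral_congr_ae ?_
  filter_upwards [coeFn_expL2 hΩ η] with x hx
  rw [hx]

/-- Density of the span of the exponentials, as the vanishing of every square integrable function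
orthogonal to all of them. -/
theorem topologicalClosure_span_expL2_eq_top_iff {Ω : Set (Fin d → ℝ)} (hΩ : volume Ω < ∞)
    (Λ : Set (Fin d → ℝ)) :
    (Submodule.span ℂ (expL2 hΩ '' Λ)).topologicalClosure = ⊤ ↔
      ∀ f : (Fin d → ℝ) → ℂ, MemLp f 2 (volume.restrict Ω) →
        (∀ ξ ∈ Λ, ∫ x in Ω, conj (expFun ξ x) * f x = 0) → f =ᵐ[volume.restrict Ω] 0 := by
  rw [Submodule.topologicalClosure_eq_top_iff, Submodule.eq_bot_iff]
  have key : ∀ f : Lp ℂ 2 (volume.restrict Ω), f ∈ (Submodule.span ℂ (expL2 hΩ '' Λ))ᗮ ↔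
      ∀ ξ ∈ Λ, ∫ x in Ω, conj (expFun ξ x) * f x = 0 := by
    intro f
    simp only [← inner_expL2_left hΩ]
    rw [Submodule.mem_orthogonal]
    refine ⟨fun h ξ hξ => h _ (Submodule.subset_span ⟨ξ, hξ, rfl⟩), fun h u hu => ?_⟩
    induction hu using Submodule.span_induction with
    | mem x hx =>
      obtain ⟨ξ, hξ, rfl⟩ := hx
      exact h ξ hξ
    | zero => simp
    | add x y _ _ hx hy => rw [inner_add_left, hx, hy, add_zero]
    | smul c x _ hx => rw [inner_smul_left, hx, mul_zero]
  constructor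
  · intro h f hf hort
    have h0 := h (hf.toLp f) ((key _).2 fun ξ hξ => by
      rw [← hort ξ hξ]
      refine integral_congr_ae ?_
      filter_upwards [hf.coeFn_toLp] with x hx
      rw [hx])
    exact (MemLp.toLp_eq_toLp_iff hf MemLp.zero).1 (h0.trans (MemLp.toLp_zero _).symm)
  · intro h f hf
    exact (Lp.eq_zero_iff_ae_eq_zero).2 (h f (Lp.memLp f) ((key f).1 hf))

theorem norm_expL2_sq {Ω : Set (Fin d → ℝ)} (hΩ : volume Ω < ∞) (ξ : Fin d → ℝ) :
    ‖expL2 hΩ ξ‖ ^ 2 = volume.real Ω := by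
  have h := inner_self_eq_norm_sq_to_K (𝕜 := ℂ) (expL2 hΩ ξ)
  rw [inner_expL2_expL2] at h
  simp only [conj_expFun_mul_self, integral_const, measureReal_restrict_apply_univ] at h
  simp only [Complex.real_smul, mul_one] at h
  exact Complex.ofReal_injective ((Complex.ofReal_pow _ 2).trans h.symm)

/-- Orthogonal exponentials are at distance √(2|Ω|), so balls of radius √|Ω|/2 about them are
disjoint open sets in the separable space L²(Ω). -/
theorem IsSpectrum.countable {Ω : Set (Fin d → ℝ)} {hΩ : volume Ω < ∞} {Λ : Set (Fin d → ℝ)}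
    (h : IsSpectrum hΩ Λ) (hpos : 0 < volume Ω) : Λ.Countable := by
  have : Fact ((2 : ℝ≥0∞) ≠ ∞) := ⟨by simp⟩
  have hr : 0 < volume.real Ω := ENNReal.toReal_pos hpos.ne' hΩ.ne
  refine Set.PairwiseDisjoint.countable_of_isOpen
    (s := fun ξ => Metric.ball (expL2 hΩ ξ) (Real.sqrt (volume.real Ω) / 2)) ?_
    (fun _ _ => Metric.isOpen_ball) (fun ξ _ => ⟨_, Metric.mem_ball_self (by positivity)⟩)
  intro ξ hξ η hη hne
  refine Metric.ball_disjoint_ball ?_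
  rw [add_halves, dist_eq_norm]
  refine Real.sqrt_le_iff.2 ⟨norm_nonneg _, ?_⟩
  rw [@norm_sub_sq ℂ, h.1 ξ hξ η hη hne, norm_expL2_sq, norm_expL2_sq]
  simp [hr.le]

theorem sq_norm_integral_le {α : Type*} [MeasurableSpace α] {μ : Measure α} [IsFiniteMeasure μ]
    {f : α → ℂ} (hf : MemLp f 2 μ) :
    ‖∫ x, f x ∂μ‖ ^ 2 ≤ μ.real Set.univ * ∫ x, ‖f x‖ ^ 2 ∂μ := by
  have h1 : Integrable (fun x => ‖f x‖) μ := (hf.integrable (by norm_num)).norm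
  have h2 : Integrable (fun x => ‖f x‖ ^ 2) μ :=
    (memLp_two_iff_integrable_sq_norm hf.1).1 hf
  set M := μ.real Set.univ
  set I := ∫ x, ‖f x‖ ∂μ with hI
  have hle : ‖∫ x, f x ∂μ‖ ≤ I := norm_integral_le_integral_norm f
  have hI0 : ‖∫ x, f x ∂μ‖ ^ 2 ≤ I ^ 2 := pow_le_pow_left₀ (norm_nonneg _) hle 2
  refine hI0.trans ?_
  rcases (measureReal_nonneg : 0 ≤ M).eq_or_lt with h0 | hpos
  · have hμ : μ = 0 := by
      rw [← Measure.measure_univ_eq_zero]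
      exact (measureReal_eq_zero_iff).1 h0.symm
    simp [hI, hμ]
  -- Cauchy–Schwarz against the constant 1, from the variance of ‖f‖ scaled by M to avoid division.
  have hsq : 0 ≤ ∫ x, (M * ‖f x‖ - I) ^ 2 ∂μ := integral_nonneg fun x => sq_nonneg _
  have hexp : ∫ x, (M * ‖f x‖ - I) ^ 2 ∂μ = M * (M * (∫ x, ‖f x‖ ^ 2 ∂μ) - I ^ 2) := by
    calc ∫ x, (M * ‖f x‖ - I) ^ 2 ∂μ
        = ∫ x, (M ^ 2 * ‖f x‖ ^ 2 - 2 * M * I * ‖f x‖) + I ^ 2 ∂μ := by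
          refine integral_congr_ae (Filter.Eventually.of_forall fun x => ?_)
          simp only
          ring
      _ = M ^ 2 * (∫ x, ‖f x‖ ^ 2 ∂μ) - 2 * M * I * I + M * I ^ 2 := by
          have h3 : Integrable (fun x => M ^ 2 * ‖f x‖ ^ 2 - 2 * M * I * ‖f x‖) μ :=
            (h2.const_mul _).sub (h1.const_mul _)
          rw [integral_add h3 (integrable_const _),
            integral_sub (h2.const_mul _) (h1.const_mul _), integral_const_mul,
            integral_const_mul, integral_const, smul_eq_mul]
      _ = _ := by ring
  rw [hexp] at hsq
  linarith [nonneg_of_mul_nonneg_right hsq hpos]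

/-! ### Spectra of stacked sets -/

/-- Restricted to the stacked set, Lebesgue measure is the image of a product measure. -/
theorem measurePreserving_layerEquiv_restrict (Ω : Set (Fin d → ℝ)) (v : Fin n → Fin d → ℝ)
    {s : Fin n → Fin k → ℤ} (hs : Function.Injective s) :
    MeasurePreserving (layerEquiv v s)
      ((volume.restrict (toReal '' Set.range s + unitCube k)).prod (volume.restrict Ω))
      (volume.restrict (stacked Ω v s)) := by
  have h := (measurePreserving_layerEquiv v s).restrict_preimage_emb
    (layerEquiv v s).measurableEmbedding (stacked Ω v s)
  rwa [Measure.restrict_congr_set (layerEquiv_preimage_stacked Ω v hs), Measure.volume_eq_prod,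
    ← Measure.prod_restrict] at h

theorem expFun_layerEquiv (v : Fin n → Fin d → ℝ) (s : Fin n → Fin k → ℤ) (ξ : Fin d → ℝ)
    (η : Fin k → ℝ) (p : (Fin k → ℝ) × (Fin d → ℝ)) :
    expFun (Fin.append ξ η) (layerEquiv v s p) =
      expFun ξ (layerShift v s p.1) * expFun η p.1 * expFun ξ p.2 := by
  rw [layerEquiv_apply, expFun_append, expFun_add]
  ring

theorem IsSpectrum.stacked {Ω : Set (Fin d → ℝ)} {v : Fin n → Fin d → ℝ}
    {s : Fin n → Fin k → ℤ} (hs : Function.Injective s) {hΩ : volume Ω < ∞}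
    (hpos : 0 < volume Ω)
    {hE : volume (toReal '' Set.range s + unitCube k) < ∞} {Λ : Set (Fin d → ℝ)}
    {M : Set (Fin k → ℝ)} (hΛ : IsSpectrum hΩ Λ) (hM : IsSpectrum hE M)
    (hst : volume (stacked Ω v s) < ∞) : IsSpectrum hst (cartesian Λ M) := by
  have hcount := hΛ.countable hpos
  have hΨ := measurePreserving_layerEquiv_restrict Ω v hs
  generalize toReal '' Set.range s + unitCube k = E at *
  have : IsFiniteMeasure (volume.restrict Ω) := ⟨by simpa using hΩ⟩
  have : IsFiniteMeasure (volume.restrict E) := ⟨by simpa using hE⟩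
  have hmeasc : ∀ ξ, Measurable fun w => expFun ξ (layerShift v s w) := fun ξ =>
    (continuous_expFun ξ).measurable.comp (measurable_layerShift v s)
  refine ⟨?_, ?_⟩
  · rintro _ ⟨ξ, hξ, η, hη, rfl⟩ _ ⟨ξ', hξ', η', hη', rfl⟩ hne
    rw [inner_expL2_expL2, ← hΨ.integral_comp']
    simp only [expFun_layerEquiv]
    calc _ = ∫ p, (conj (expFun ξ (layerShift v s p.1) * expFun η p.1) *
            (expFun ξ' (layerShift v s p.1) * expFun η' p.1)) *
            (conj (expFun ξ p.2) * expFun ξ' p.2)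
            ∂(volume.restrict E).prod (volume.restrict Ω) := by
          refine integral_congr_ae (Filter.Eventually.of_forall fun p => ?_)
          simp only [map_mul]
          ring
      _ = (∫ w in E, conj (expFun ξ (layerShift v s w) * expFun η w) *
            (expFun ξ' (layerShift v s w) * expFun η' w)) *
            ∫ u in Ω, conj (expFun ξ u) * expFun ξ' u :=
          integral_prod_mul
            (fun w => conj (expFun ξ (layerShift v s w) * expFun η w) *
              (expFun ξ' (layerShift v s w) * expFun η' w))
            (fun u => conj (expFun ξ u) * expFun ξ' u)
      _ = 0 := by
          by_cases hξξ : ξ = ξ'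
          · subst hξξ
            have hηη : η ≠ η' := fun h => hne (by rw [h])
            have h0 := hM.1 η hη η' hη' hηη
            rw [inner_expL2_expL2] at h0
            rw [← zero_mul (∫ u in Ω, conj (expFun ξ u) * expFun ξ u), ← h0]
            congr 1
            refine integral_congr_ae (Filter.Eventually.of_forall fun w => ?_)
            simp only [map_mul]
            linear_combination (conj (expFun η w) * expFun η' w) *
              conj_expFun_mul_self ξ (layerShift v s w)
          · rw [← inner_expL2_expL2 hΩ, hΛ.1 ξ hξ ξ' hξ' hξξ, mul_zero]
  · rw [topologicalClosure_span_expL2_eq_top_iff]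
    intro f hf hort
    set g := f ∘ layerEquiv v s with hg
    have hgL : MemLp g 2 ((volume.restrict E).prod (volume.restrict Ω)) :=
      hf.comp_measurePreserving hΨ
    have hg2 := (memLp_two_iff_integrable_sq_norm hgL.1).1 hgL
    have hslice : ∀ᵐ w ∂volume.restrict E, MemLp (fun u => g (w, u)) 2 (volume.restrict Ω) := by
      filter_upwards [hgL.1.prodMk_left, hg2.prod_right_ae] with w h1 h2
      exact (memLp_two_iff_integrable_sq_norm h1).2 h2
    have hcoef : ∀ ξ ∈ Λ, ∀ᵐ w ∂volume.restrict E,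
        ∫ u in Ω, conj (expFun ξ u) * g (w, u) = 0 := by
      intro ξ hξ
      have hcont : Continuous fun u => conj (expFun ξ u) :=
        Complex.continuous_conj.comp (continuous_expFun ξ)
      have hGm : AEStronglyMeasurable
          (fun w => ∫ u in Ω, conj (expFun ξ u) * g (w, u)) (volume.restrict E) :=
        AEStronglyMeasurable.integral_prod_right' (f := fun p => conj (expFun ξ p.2) * g p)
          ((hcont.comp continuous_snd).aestronglyMeasurable.mul hgL.1)
      have hcm : Measurable fun w => conj (expFun ξ (layerShift v s w)) :=
        Complex.continuous_conj.measurable.comp (hmeasc ξ)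
      -- The phase stays attached to the coefficient, so that the integral over Ω' becomes pairing
      -- with the pure exponential η on E.
      have hG : MemLp (fun w => conj (expFun ξ (layerShift v s w)) *
          ∫ u in Ω, conj (expFun ξ u) * g (w, u)) 2 (volume.restrict E) := by
        have hm := hcm.aestronglyMeasurable (μ := volume.restrict E) |>.mul hGm
        refine (memLp_two_iff_integrable_sq_norm hm).2 ?_
        refine (hg2.integral_prod_left.const_mul ((volume.restrict Ω).real Set.univ)).mono'
          (hm.norm.pow 2) ?_
        filter_upwards [hslice] with w hw
        have hw' : MemLp (fun u => conj (expFun ξ u) * g (w, u)) 2 (volume.restrict Ω) := by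
          refine hw.of_le (hcont.aestronglyMeasurable.mul hw.1)
            (Filter.Eventually.of_forall fun u => ?_)
          simp [norm_expFun]
        have := sq_norm_integral_le hw'
        simpa [norm_expFun] using this
      have h0 := (topologicalClosure_span_expL2_eq_top_iff hE M).1 hM.2 _ hG fun η hη => by
        have h := hort (Fin.append ξ η) ⟨ξ, hξ, η, hη, rfl⟩
        rw [← hΨ.integral_comp', integral_prod] at h
        · rw [← h]
          refine integral_congr_ae (Filter.Eventually.of_forall fun w => ?_)
          simp only [← integral_const_mul]
          refine integral_congr_ae (Filter.Eventually.of_forall fun u => ?_)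
          simp only [expFun_layerEquiv, map_mul, hg, Function.comp_apply]
          ring
        · refine (hgL.integrable (by norm_num)).mono ?_ (Filter.Eventually.of_forall fun p => ?_)
          · exact ((Complex.continuous_conj.measurable.comp (continuous_expFun _).measurable).comp
              (layerEquiv v s).measurable).aestronglyMeasurable.mul hgL.1
          · simp [norm_expFun, hg]
      filter_upwards [h0] with w hw
      refine (mul_eq_zero.1 hw).resolve_left fun h => ?_
      have := norm_expFun ξ (layerShift v s w)
      rw [← RCLike.norm_conj, h] at this
      simp at this
    have hz : ∀ᵐ w ∂volume.restrict E, ∫ u in Ω, ‖g (w, u)‖ ^ 2 = 0 := by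
      -- Countability of Λ merges the exceptional null sets, so almost every slice is orthogonal to
      -- all of Λ.
      filter_upwards [(ae_ball_iff hcount).2 hcoef, hslice] with w h1 h2
      have h3 := (topologicalClosure_span_expL2_eq_top_iff hΩ Λ).1 hΛ.2 _ h2 h1
      refine integral_eq_zero_of_ae ?_
      filter_upwards [h3] with u hu
      simp [hu]
    have hg0 : g =ᵐ[(volume.restrict E).prod (volume.restrict Ω)] 0 := by
      have hint : ∫ p, ‖g p‖ ^ 2 ∂(volume.restrict E).prod (volume.restrict Ω) = 0 := by
        rw [integral_prod _ hg2]
        exact integral_eq_zero_of_ae hz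
      filter_upwards [(integral_eq_zero_iff_of_nonneg (fun p => by positivity) hg2).1 hint]
        with p hp
      simpa using hp
    have hfin := hΨ.symm.quasiMeasurePreserving.ae hg0
    filter_upwards [hfin] with x hx
    simpa [hg] using hx

theorem IsSpectral.stacked {Ω : Set (Fin d → ℝ)} (hΩ : IsSpectral Ω) (v : Fin n → Fin d → ℝ)
    {s : Fin n → Fin k → ℤ} (hs : Function.Injective s)
    (hE : IsSpectral (toReal '' Set.range s + unitCube k)) : IsSpectral (stacked Ω v s) := by
  obtain ⟨hm, hpos, hfin, Λ, hΛ⟩ := hΩ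
  obtain ⟨-, hEpos, hEfin, M, hM⟩ := hE
  have hv := volume_stacked Ω v hs
  have hst : volume (TileSpectral.stacked Ω v s) < ∞ := hv ▸ ENNReal.mul_lt_top hEfin hfin
  exact ⟨nullMeasurableSet_stacked hm v hs, hv ▸ ENNReal.mul_pos hEpos.ne' hpos.ne', hst,
    cartesian Λ M, IsSpectrum.stacked hs hpos hΛ hM hst⟩

end TileSpectral

theorem mainTheorem4 (d k n : ℕ) (Ω : Set (Fin d → ℝ)) (hbdd : Bornology.IsBounded Ω)
    (hmeas : NullMeasurableSet Ω volume) (v : Fin n → Fin d → ℝ) (s : Fin n → Fin k → ℤ)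
    (hs : Function.Injective s) :
    (TileSpectral.TilesInt (Set.range s) →
      (TileSpectral.Tiles (TileSpectral.stacked Ω v s) ↔ TileSpectral.Tiles Ω)) ∧
    (TileSpectral.IsSpectral Ω →
      TileSpectral.IsSpectral
        (TileSpectral.toReal '' Set.range s + TileSpectral.unitCube k) →
      TileSpectral.IsSpectral (TileSpectral.stacked Ω v s)) := by
  refine ⟨fun hS => ⟨fun h => ?_, fun h => h.stacked v hs hS⟩, fun h hE => h.stacked v hs hE⟩
  obtain ⟨-, T, hT⟩ := hS
  obtain ⟨t, ⟨-, _, ⟨j, -⟩, -⟩, -⟩ := hT 0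
  exact TileSpectral.Tiles.of_stacked hmeas hs j h
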